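/- Let $\mathbb{F}$ be an algebraically closed field (of arbitrary characteristic) and let $d,n\ge 1$ be integers. Let $N(d,n)$ be the set of all $d$-tuples $(A_1,\dots,A_d)$ of pairwise commuting nilpotent $n\times n$ matrices over $\mathbb{F}$, regarded as a subset of the affine space $\mathbb{F}^{dn^2}$ with its Zariski topology. A square matrix is called 1-regular if each of its eigenspaces is at most one-dimensional. Let $R_1(d,n)$ be the set of all $(A_1,\dots,A_d)\in N(d,n)$ such that $A_1$ is 1-regular. Then the Zariski closure $\overline{R_1(d,n)}$ in $\mathbb{F}^{dn^2}$ is an irreducible variety, and its dimension is $$\dim\overline{R_1(d,n)}=(n+d-1)(n-1).$$ -/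

import Mathlib

theorem zeroLocus_union_eq {F σ : Type*} [Field F] (I J : Ideal (MvPolynomial σ F)) :
    MvPolynomial.zeroLocus F I ∪ MvPolynomial.zeroLocus F J =
      MvPolynomial.zeroLocus F (I ⊓ J) := by
  ext x
  simp only [Set.mem_union, MvPolynomial.mem_zeroLocus_iff]
  constructor
  · rintro (hx | hx) p hp
    · exact hx p hp.1
    · exact hx p hp.2
  · intro hx
    by_contra! hne
    obtain ⟨⟨p, hp, hpx⟩, ⟨q, hq, hqx⟩⟩ := hne
    have h := hx (p * q) ⟨I.mul_mem_right q hp, J.mul_mem_left p hq⟩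
    rw [map_mul] at h
    exact (mul_ne_zero hpx hqx) h

theorem zeroLocus_sInter_eq {F σ : Type*} [Field F] (A : Set (Set (σ → F)))
    (hA : ∀ Z ∈ A, ∃ I : Ideal (MvPolynomial σ F), Z = MvPolynomial.zeroLocus F I) :
    ⋂₀ A = MvPolynomial.zeroLocus F
      (sSup {I : Ideal (MvPolynomial σ F) | MvPolynomial.zeroLocus F I ∈ A}) := by
  ext x
  constructor
  · intro hx
    have h : sSup {I : Ideal (MvPolynomial σ F) | MvPolynomial.zeroLocus F I ∈ A} ≤
        MvPolynomial.vanishingIdeal F {x} := by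
      refine sSup_le fun I hI p hp y hy => ?_
      obtain rfl : y = x := hy
      exact hx _ hI p hp
    exact fun p hp => h hp x rfl
  · intro hx Z hZ
    obtain ⟨I, rfl⟩ := hA Z hZ
    exact fun p hp => hx p (le_sSup (a := I) hZ hp)

/-- The Zariski topology on the affine space `F^σ`: the closed sets are the zero loci of
ideals of polynomials. -/
@[reducible] def zariskiTopology (F σ : Type*) [Field F] : TopologicalSpace (σ → F) :=
  TopologicalSpace.ofClosed
    {Z | ∃ I : Ideal (MvPolynomial σ F), Z = MvPolynomial.zeroLocus F I}
    ⟨⊤, MvPolynomial.zeroLocus_top.symm⟩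
    (fun A hA => ⟨_, zeroLocus_sInter_eq A hA⟩)
    (by
      rintro _ ⟨I, rfl⟩ _ ⟨J, rfl⟩
      exact ⟨I ⊓ J, zeroLocus_union_eq I J⟩)

/-- The Zariski topology on `d`-tuples of `n × n` matrices, identified with the affine space
`F^(d n²)` through the entries of the matrices. -/
@[reducible] def tupleZariskiTopology (F : Type*) [Field F] (d n : ℕ) :
    TopologicalSpace (Fin d → Matrix (Fin n) (Fin n) F) :=
  TopologicalSpace.induced
    (fun (A : Fin d → Matrix (Fin n) (Fin n) F) (k : Fin d × Fin n × Fin n) => A k.1 k.2.1 k.2.2)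
    (zariskiTopology F (Fin d × Fin n × Fin n))

/-- A square matrix is `r`-regular if each of its eigenspaces is at most `r`-dimensional. -/
def IsRRegular {F : Type*} [Field F] {n : ℕ} (r : ℕ) (A : Matrix (Fin n) (Fin n) F) : Prop :=
  ∀ c : F, Module.finrank F (Module.End.eigenspace (Matrix.toLin' A) c) ≤ r

/-- `N(d,n)`: the `d`-tuples of pairwise commuting nilpotent `n × n` matrices. -/
def commutingNilpotentTuples (F : Type*) [Field F] (d n : ℕ) :
    Set (Fin d → Matrix (Fin n) (Fin n) F) :=
  {A | (∀ i j, A i * A j = A j * A i) ∧ ∀ i, IsNilpotent (A i)}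

/-- `R₁(d,n)`: the tuples in `N(d,n)` whose first matrix is 1-regular. -/
def firstRegularTuples (F : Type*) [Field F] (d n : ℕ) [NeZero d] :
    Set (Fin d → Matrix (Fin n) (Fin n) F) :=
  {A | A ∈ commutingNilpotentTuples F d n ∧ IsRRegular 1 (A 0)}

/-!
The set `R₁` is described through Krylov bases. A nilpotent `n × n` matrix `A` is 1-regular exactly
when `A ^ (n - 1) ≠ 0` (`isRRegular_one_iff`), and then it has a cyclic vector `v`: the Krylov
matrix `K` with columns `v, A v, …, A ^ (n - 1) v` is invertible and `A K = K J` for the nilpotent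
Jordan block `J`. A matrix `B` commuting with `A` is determined by `B v`, so it is `K p(J) K⁻¹` for
a polynomial `p`, which has no constant term if `B` is nilpotent
(`mul_krylov_of_commute`, `krylovCoord_zero_eq_zero`).

*Irreducibility.* Replacing inverses by adjugates and absorbing the determinant into the
coefficients of the polynomials, `R₁` is the image under a polynomial map of a principal open subset
of an affine space (`conjTuple_mem_firstRegularTuples`, `exists_eq_conjTuple`). Hence its vanishing
ideal is the kernel of a ring homomorphism into a polynomial ring and is prime
(`isPrime_regularIdeal`).

*Dimension.* By the Nullstellensatz the dimension of the closure is the Krull dimension of its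
coordinate ring (`topologicalKrullDim_zeroLocus`), and by Noether normalization this is the
transcendence degree (`ringKrullDim_eq_card_of_isTranscendenceBasis`). Generically the first
standard basis vector `e₀` is cyclic for `A_1`, which makes the choice of `K` canonical. The
`n (n - 1)` entries of `K` outside its first column `e₀`, and the `(d - 1)(n - 1)` entries after the
first of the vectors `adj(K) A_k e₀`, `k ≥ 2`, form a transcendence basis
(`isTranscendenceBasis_regularCoordinates`). They are independent because `K` (with `det K ≠ 0`) and
these vectors can be prescribed on `R₁`. The coordinate ring is algebraic over them because
`det K • A_1` and `(det K)² • A_k` are polynomial in them. Their number is `(n + d - 1)(n - 1)`.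
-/

/-! ### Dimension of finitely generated domains -/

/-- Going up and incomparability show that an integral extension preserves Krull dimension. -/
theorem ringKrullDim_eq_of_isIntegral (R S : Type*) [CommRing R] [CommRing S] [Algebra R S]
    [Algebra.IsIntegral R S] [FaithfulSMul R S] : ringKrullDim S = ringKrullDim R := by
  apply le_antisymm
  · refine Order.krullDim_le_of_strictMono (PrimeSpectrum.comap (algebraMap R S)) ?_
    intro P Q h
    exact Ideal.IsIntegral.comap_lt_comap (R := R) (I := P.asIdeal) (J := Q.asIdeal) h
  · refine iSup_le fun l => ?_
    obtain ⟨⟨P, hP, hlo⟩⟩ : Nonempty (Ideal.primesOver (RelSeries.head l).asIdeal S) :=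
      inferInstance
    obtain ⟨L, hL, -⟩ := Ideal.exists_ltSeries_of_hasGoingUp l P
    rw [← hL]
    exact le_iSup (fun p : LTSeries (PrimeSpectrum S) => (p.length : WithBot ℕ∞)) L

/-- For a finitely generated domain over a field, the Krull dimension is the transcendence degree:
by Noether normalization both agree with those of a polynomial ring. -/
theorem ringKrullDim_eq_card_of_isTranscendenceBasis {F A τ : Type*} [Field F] [CommRing A]
    [IsDomain A] [Algebra F A] [Algebra.FiniteType F A] [Finite τ] {x : τ → A}
    (hx : IsTranscendenceBasis F x) : ringKrullDim A = (Nat.card τ : WithBot ℕ∞) := by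
  obtain ⟨s, g, hg, hint⟩ := exists_integral_inj_algHom_of_fg F A
  let : Algebra (MvPolynomial (Fin s) F) A := g.toRingHom.toAlgebra
  have : IsScalarTower F (MvPolynomial (Fin s) F) A :=
    IsScalarTower.of_algebraMap_eq fun r => (g.commutes r).symm
  have : Algebra.IsIntegral (MvPolynomial (Fin s) F) A := ⟨hint⟩
  have : FaithfulSMul (MvPolynomial (Fin s) F) A :=
    (faithfulSMul_iff_algebraMap_injective _ _).2 hg
  have hb : IsTranscendenceBasis F
      (algebraMap (MvPolynomial (Fin s) F) A ∘ (MvPolynomial.X : Fin s → _)) :=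
    (IsTranscendenceBasis.mvPolynomial (Fin s) F).algebraMap_comp
  have hs : Nat.card τ = s := by
    have h := congrArg Cardinal.toNat (hx.lift_cardinalMk_eq hb)
    simpa [Nat.card] using h
  rw [ringKrullDim_eq_of_isIntegral (MvPolynomial (Fin s) F) A,
    MvPolynomial.ringKrullDim_of_isNoetherianRing, hs]
  simp

/-! ### The Zariski topology on affine space -/

theorem isIrreducible_of_isIrreducible_image {X Y : Type*} [TopologicalSpace X]
    [TopologicalSpace Y] {f : X → Y} (hf : Topology.IsInducing f) {s : Set X}
    (hs : IsIrreducible (f '' s)) : IsIrreducible s := by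
  refine ⟨Set.image_nonempty.1 hs.1, fun u v hu hv hsu hsv => ?_⟩
  obtain ⟨u, hu', rfl⟩ := hf.isOpen_iff.1 hu
  obtain ⟨v, hv', rfl⟩ := hf.isOpen_iff.1 hv
  have h := hs.2 u v hu' hv'
  simp only [Set.image_inter_nonempty_iff] at h
  exact h hsu hsv

section Zariski

open MvPolynomial TopologicalSpace

attribute [local instance] zariskiTopology

variable {F σ : Type*} [Field F]

theorem isClosed_zariski_iff {Z : Set (σ → F)} :
    IsClosed Z ↔ ∃ I : Ideal (MvPolynomial σ F), Z = zeroLocus F I := by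
  rw [← isOpen_compl_iff]
  change (∃ I : Ideal (MvPolynomial σ F), Zᶜᶜ = zeroLocus F I) ↔ _
  rw [compl_compl]

theorem isClosed_zeroLocus (I : Ideal (MvPolynomial σ F)) : IsClosed (zeroLocus F I) :=
  isClosed_zariski_iff.2 ⟨I, rfl⟩

theorem closure_zariski_eq (W : Set (σ → F)) : closure W = zeroLocus F (vanishingIdeal F W) := by
  refine (closure_minimal (zeroLocus_vanishingIdeal_le W) (isClosed_zeroLocus _)).antisymm ?_
  obtain ⟨I, hI⟩ := isClosed_zariski_iff.1 (isClosed_closure (s := W))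
  rw [hI]
  exact zeroLocus_anti_mono (le_zeroLocus_iff_le_vanishingIdeal.1 (hI ▸ subset_closure))

/-- Irreducibility of an arbitrary, not necessarily closed, set of points is primality of its
vanishing ideal. -/
theorem isIrreducible_zariski_iff {W : Set (σ → F)} :
    IsIrreducible W ↔ (vanishingIdeal F W).IsPrime := by
  constructor
  · rintro ⟨⟨x, hx⟩, hW⟩
    refine ⟨fun h => ?_, fun {p q} hpq => ?_⟩
    · have : (1 : MvPolynomial σ F) ∈ vanishingIdeal F W := h ▸ Submodule.mem_top
      simpa using this x hx
    · have h := isPreirreducible_iff_isClosed_union_isClosed.1 hW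
        (zeroLocus F (Ideal.span {p})) (zeroLocus F (Ideal.span {q}))
        (isClosed_zeroLocus _) (isClosed_zeroLocus _) (fun y hy => by
          have := hpq y hy
          rw [map_mul, mul_eq_zero] at this
          simpa [zeroLocus_span] using this)
      simpa [zeroLocus_span, Set.subset_def] using h
  · intro h
    refine ⟨?_, ?_⟩
    · rw [Set.nonempty_iff_ne_empty]
      rintro rfl
      exact h.ne_top (vanishingIdeal_empty (σ := σ))
    · rw [isPreirreducible_iff_isClosed_union_isClosed]
      rintro _ _ hZ₁ hZ₂ hW
      obtain ⟨I, rfl⟩ := isClosed_zariski_iff.1 hZ₁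
      obtain ⟨J, rfl⟩ := isClosed_zariski_iff.1 hZ₂
      rw [zeroLocus_union_eq] at hW
      have := le_zeroLocus_iff_le_vanishingIdeal.1 hW
      rcases (h.inf_le).1 this with h | h
      · exact Or.inl (le_zeroLocus_iff_le_vanishingIdeal.2 h)
      · exact Or.inr (le_zeroLocus_iff_le_vanishingIdeal.2 h)

/-- The Nullstellensatz identifies the irreducible closed subsets of the zero set of an ideal with
the primes containing that ideal, so the dimension of the zero set is that of the quotient ring. -/
theorem topologicalKrullDim_zeroLocus [IsAlgClosed F] [Finite σ] (I : Ideal (MvPolynomial σ F)) :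
    topologicalKrullDim (zeroLocus F I) = ringKrullDim (MvPolynomial σ F ⧸ I) := by
  rw [ringKrullDim_quotient, topologicalKrullDim,
    ← Order.krullDim_orderDual (α := PrimeSpectrum.zeroLocus _)]
  have hval := (isClosed_zeroLocus I).isClosedEmbedding_subtypeVal
  apply le_antisymm
  · refine Order.krullDim_le_of_strictMono (fun C => OrderDual.toDual
      ⟨⟨vanishingIdeal F (Subtype.val '' (C : Set (zeroLocus F I))),
        isIrreducible_zariski_iff.1 (C.isIrreducible.image _ hval.continuous.continuousOn)⟩, ?_⟩) ?_
    · rw [PrimeSpectrum.mem_zeroLocus]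
      exact le_zeroLocus_iff_le_vanishingIdeal.1 (by rintro _ ⟨x, -, rfl⟩; exact x.2)
    · intro C D hCD
      have hle : ∀ C D : IrreducibleCloseds (zeroLocus F I),
          vanishingIdeal F (Subtype.val '' (D : Set (zeroLocus F I))) ≤
            vanishingIdeal F (Subtype.val '' (C : Set (zeroLocus F I))) → C ≤ D := by
        intro C D h x hx
        have hx' : (x : σ → F) ∈ Subtype.val '' (D : Set (zeroLocus F I)) := by
          rw [← (hval.isClosedMap _ D.isClosed).closure_eq, closure_zariski_eq]
          exact fun p hp => h hp _ ⟨x, hx, rfl⟩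
        obtain ⟨y, hy, hxy⟩ := hx'
        rwa [← Subtype.ext hxy]
      refine lt_of_le_not_ge ?_ fun h => hCD.not_ge (hle _ _ h)
      exact vanishingIdeal_anti_mono (Set.image_mono hCD.le)
  · have hval' : ∀ Q : PrimeSpectrum.zeroLocus (I : Set (MvPolynomial σ F)),
        Subtype.val '' (Subtype.val ⁻¹' zeroLocus F Q.1.asIdeal : Set (zeroLocus F I)) =
          zeroLocus F Q.1.asIdeal := fun Q => by
      rw [Subtype.image_preimage_coe]
      exact Set.inter_eq_right.2 (zeroLocus_anti_mono Q.2)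
    refine Order.krullDim_le_of_strictMono (fun Q =>
      ⟨Subtype.val ⁻¹' zeroLocus F Q.ofDual.1.asIdeal, ?_,
        (isClosed_zeroLocus _).preimage hval.continuous⟩) ?_
    · refine isIrreducible_of_isIrreducible_image hval.isInducing ?_
      rw [hval', isIrreducible_zariski_iff]
      have := Q.ofDual.1.isPrime
      rwa [IsPrime.vanishingIdeal_zeroLocus]
    · intro Q Q' h
      refine lt_of_le_not_ge (fun x hx => zeroLocus_anti_mono h.le hx) fun hle => h.not_ge ?_
      have hle' := Set.image_mono (f := Subtype.val) (show
        (Subtype.val ⁻¹' zeroLocus F Q'.ofDual.1.asIdeal : Set (zeroLocus F I)) ⊆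
          Subtype.val ⁻¹' zeroLocus F Q.ofDual.1.asIdeal from hle)
      rw [hval', hval'] at hle'
      have := Q'.ofDual.1.isPrime
      have hle'' := le_zeroLocus_iff_le_vanishingIdeal.1 hle'
      rwa [IsPrime.vanishingIdeal_zeroLocus] at hle''

end Zariski

/-! ### Sets parametrized by principal open sets -/

section Parametrized

open MvPolynomial

variable {F ι σ τ : Type*} [Field F] [Infinite F]

theorem eq_zero_of_eval_eq_zero_of_ne {h p : MvPolynomial σ F} (hh : h ≠ 0)
    (hp : ∀ y, eval y h ≠ 0 → eval y p = 0) : p = 0 := by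
  have : h * p = 0 := MvPolynomial.funext fun y => by
    by_cases hy : eval y h = 0
    · simp [hy]
    · simp [hp y hy]
  exact (mul_eq_zero.1 this).resolve_left hh

/-- The image of a nonempty principal open set of affine space under a polynomial map has a prime
vanishing ideal, namely the kernel of the pullback of polynomials. -/
theorem isPrime_vanishingIdeal_of_parametrization {W : Set (ι → F)} (ψ : ι → MvPolynomial σ F)
    {h : MvPolynomial σ F} (hh : h ≠ 0)
    (hW : ∀ x, x ∈ W ↔ ∃ y, eval y h ≠ 0 ∧ ∀ i, x i = eval y (ψ i)) :
    (vanishingIdeal F W).IsPrime := by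
  have key : vanishingIdeal F W = RingHom.ker (aeval (R := F) ψ) := by
    ext p
    have hcomp : ∀ y : σ → F, eval y (aeval ψ p) = aeval (fun i => eval y (ψ i)) p := fun y => by
      rw [← coe_aeval_eq_eval, RingHom.coe_coe, ← AlgHom.comp_apply, comp_aeval]
    rw [mem_vanishingIdeal_iff, RingHom.mem_ker]
    constructor
    · intro hp
      refine eq_zero_of_eval_eq_zero_of_ne hh fun y hy => ?_
      rw [hcomp]
      exact hp _ ((hW _).2 ⟨y, hy, fun _ => rfl⟩)
    · intro hp x hx
      obtain ⟨y, -, hy⟩ := (hW x).1 hx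
      rw [show x = _ from funext hy, ← hcomp, hp, map_zero]
  rw [key]
  exact RingHom.ker_isPrime _

/-- Regular functions on `W` that attain together every value off a hypersurface are algebraically
independent. -/
theorem algebraicIndependent_quotient_vanishingIdeal {W : Set (ι → F)}
    (p : τ → MvPolynomial ι F) {D : MvPolynomial τ F} (hD : D ≠ 0)
    (hp : ∀ a, eval a D ≠ 0 → ∃ x ∈ W, ∀ t, eval x (p t) = a t) :
    AlgebraicIndependent F fun t => Ideal.Quotient.mk (vanishingIdeal F W) (p t) := by
  rw [algebraicIndependent_iff]
  intro f hf
  have hmem : aeval p f ∈ vanishingIdeal F W := by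
    rw [← Ideal.Quotient.eq_zero_iff_mem, ← hf, ← Ideal.Quotient.mkₐ_eq_mk F,
      ← AlgHom.comp_apply, comp_aeval]
  refine eq_zero_of_eval_eq_zero_of_ne hD fun a ha => ?_
  obtain ⟨x, hx, hxa⟩ := hp a ha
  have h := hmem x hx
  rw [← AlgHom.comp_apply, comp_aeval] at h
  rw [show (fun i => aeval x (p i)) = a from funext hxa] at h
  exact h

/-- A finitely generated domain is algebraic over a subalgebra `S` as soon as each generator has a
nonzero multiple, by an element of `S`, that lies in `S`. -/
theorem isAlgebraic_of_adjoin_eq_top {F A : Type*} [Field F] [CommRing A] [IsDomain A]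
    [Algebra F A] (S : Subalgebra F A) {s : Set A} (hs : Algebra.adjoin F s = ⊤)
    (h : ∀ x ∈ s, ∃ b ∈ S, b ≠ 0 ∧ b * x ∈ S) : Algebra.IsAlgebraic S A := by
  have hle : Algebra.adjoin F s ≤ (Subalgebra.algebraicClosure S A).restrictScalars F := by
    refine Algebra.adjoin_le fun x hx => ?_
    obtain ⟨b, hb, hb0, hbx⟩ := h x hx
    change IsAlgebraic S x
    refine IsAlgebraic.of_smul (y := (⟨b, hb⟩ : S))
      (mem_nonZeroDivisors_of_ne_zero fun h0 => hb0 (congrArg Subtype.val h0)) ?_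
    exact isAlgebraic_algebraMap (⟨b * x, hbx⟩ : S)
  exact ⟨fun x => hle (hs ▸ Algebra.mem_top)⟩

end Parametrized

/-! ### Shift matrices, Toeplitz matrices and Krylov matrices -/

section Krylov

open Matrix

variable {R : Type*} [CommRing R] {m : ℕ}

/-- The nilpotent Jordan block with ones on the subdiagonal, so that it sends each standard basis
vector to the next one. -/
def shiftMatrix (R : Type*) [CommRing R] (m : ℕ) : Matrix (Fin (m + 1)) (Fin (m + 1)) R :=
  Matrix.of fun i j => if (i : ℕ) = j + 1 then 1 else 0

/-- The polynomial `∑ c_l J ^ (l + 1)` without constant term in the Jordan block `J`, i.e. the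
strictly lower triangular Toeplitz matrix whose first column is `(0, c)`. -/
def nilToeplitz (c : Fin m → R) : Matrix (Fin (m + 1)) (Fin (m + 1)) R :=
  ∑ l, c l • shiftMatrix R m ^ ((l : ℕ) + 1)

/-- The matrix with columns `v, A v, …, A ^ m v`. -/
def krylov (A : Matrix (Fin (m + 1)) (Fin (m + 1)) R) (v : Fin (m + 1) → R) :
    Matrix (Fin (m + 1)) (Fin (m + 1)) R :=
  Matrix.of fun i j => (A ^ (j : ℕ) *ᵥ v) i

theorem shiftMatrix_pow_apply (k : ℕ) (i j : Fin (m + 1)) :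
    (shiftMatrix R m ^ k) i j = if (i : ℕ) = j + k then 1 else 0 := by
  induction k generalizing i with
  | zero => simp [Matrix.one_apply, Fin.ext_iff]
  | succ k ih =>
    rw [pow_succ', Matrix.mul_apply]
    simp only [ih, show ∀ i b, shiftMatrix R m i b = if (i : ℕ) = b + 1 then 1 else 0 from
      fun _ _ => rfl, mul_ite, mul_one, mul_zero]
    by_cases h : (j : ℕ) + k < m + 1
    · rw [Finset.sum_eq_single ⟨j + k, h⟩]
      · simp [add_assoc]
      · intro b _ hb
        rw [if_neg]
        exact fun h' => hb (Fin.ext h')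
      · simp
    · rw [Finset.sum_eq_zero, if_neg]
      · have := i.2; omega
      · intro b _
        rw [if_neg]
        have := b.2; omega

theorem shiftMatrix_pow_succ_eq_zero : shiftMatrix R m ^ (m + 1) = 0 := by
  ext i j
  rw [shiftMatrix_pow_apply, if_neg (by have := i.2; omega), Matrix.zero_apply]

theorem shiftMatrix_pow_ne_zero [Nontrivial R] : shiftMatrix R m ^ m ≠ 0 := fun h => by
  have := congrFun (congrFun h (Fin.last m)) 0
  rw [shiftMatrix_pow_apply] at this
  simp at this

theorem nilToeplitz_apply_succ_zero (c : Fin m → R) (l : Fin m) :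
    nilToeplitz c l.succ 0 = c l := by
  simp only [nilToeplitz, Matrix.sum_apply, Matrix.smul_apply, shiftMatrix_pow_apply]
  rw [Finset.sum_eq_single l]
  · simp
  · intro b _ hb
    rw [if_neg, smul_zero]
    simpa [Fin.ext_iff, eq_comm] using hb
  · simp

theorem commute_shiftMatrix_nilToeplitz (c : Fin m → R) :
    Commute (shiftMatrix R m) (nilToeplitz c) :=
  Commute.sum_right _ _ _ fun _ _ => ((Commute.refl _).pow_right _).smul_right _

theorem commute_nilToeplitz (c c' : Fin m → R) : Commute (nilToeplitz c) (nilToeplitz c') :=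
  Commute.sum_right _ _ _ fun _ _ =>
    ((commute_shiftMatrix_nilToeplitz c).symm.pow_right _).smul_right _

theorem isNilpotent_nilToeplitz (c : Fin m → R) : IsNilpotent (nilToeplitz c) := by
  have h : nilToeplitz c =
      shiftMatrix R m * ∑ l, c l • shiftMatrix R m ^ (l : ℕ) := by
    simp only [nilToeplitz, Finset.mul_sum, mul_smul_comm, pow_succ']
  rw [h]
  refine Commute.isNilpotent_mul_right ?_ ⟨m + 1, shiftMatrix_pow_succ_eq_zero⟩
  exact Commute.sum_right _ _ _ fun _ _ => ((Commute.refl _).pow_right _).smul_right _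

theorem krylov_mulVec (A : Matrix (Fin (m + 1)) (Fin (m + 1)) R) (v w : Fin (m + 1) → R) :
    krylov A v *ᵥ w = (∑ l, w l • A ^ (l : ℕ)) *ᵥ v := by
  ext i
  simp only [Matrix.mulVec, dotProduct, krylov, Matrix.of_apply, Matrix.sum_apply,
    Matrix.smul_apply, Finset.sum_mul, smul_eq_mul]
  rw [Finset.sum_comm]
  refine Finset.sum_congr rfl fun l _ => Finset.sum_congr rfl fun k _ => ?_
  ring

theorem krylov_mulVec_single (A : Matrix (Fin (m + 1)) (Fin (m + 1)) R) (v : Fin (m + 1) → R)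
    (j : Fin (m + 1)) : krylov A v *ᵥ Pi.single j 1 = A ^ (j : ℕ) *ᵥ v := by
  ext i
  simp [krylov]

theorem krylov_apply_zero (A : Matrix (Fin (m + 1)) (Fin (m + 1)) R) (v : Fin (m + 1) → R)
    (i : Fin (m + 1)) : krylov A v i 0 = v i := by
  simp [krylov]

theorem mul_krylov {A : Matrix (Fin (m + 1)) (Fin (m + 1)) R} (hA : A ^ (m + 1) = 0)
    (v : Fin (m + 1) → R) : A * krylov A v = krylov A v * shiftMatrix R m := by
  refine Matrix.ext_of_mulVec_single fun j => ?_
  have hJ : shiftMatrix R m *ᵥ Pi.single j 1 =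
      fun i : Fin (m + 1) => if (i : ℕ) = j + 1 then 1 else 0 := by
    ext i; simp [shiftMatrix]
  rw [← Matrix.mulVec_mulVec, ← Matrix.mulVec_mulVec, krylov_mulVec_single, Matrix.mulVec_mulVec,
    ← pow_succ', hJ]
  by_cases hj : (j : ℕ) + 1 < m + 1
  · have : (fun i : Fin (m + 1) => if (i : ℕ) = j + 1 then (1 : R) else 0) =
        Pi.single ⟨j + 1, hj⟩ 1 := by
      ext i; simp [Pi.single_apply, Fin.ext_iff]
    rw [this, krylov_mulVec_single]
  · have : (fun i : Fin (m + 1) => if (i : ℕ) = j + 1 then (1 : R) else 0) = 0 := by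
      ext i
      rw [if_neg (by have := i.2; omega), Pi.zero_apply]
    rw [this, Matrix.mulVec_zero, show (j : ℕ) + 1 = m + 1 by have := j.2; omega, hA,
      Matrix.zero_mulVec]

/-- A matrix commuting with `A` is determined by its value at `v`, and it acts on the Krylov basis
of `A` and `v` as a Toeplitz matrix. -/
theorem mul_krylov_of_commute {A B : Matrix (Fin (m + 1)) (Fin (m + 1)) R}
    (hA : A ^ (m + 1) = 0) (hAB : Commute A B) {v w : Fin (m + 1) → R}
    (hw : B *ᵥ v = krylov A v *ᵥ w) :
    B * krylov A v = krylov A v * ∑ l, w l • shiftMatrix R m ^ (l : ℕ) := by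
  have h1 : B * krylov A v = (∑ l, w l • A ^ (l : ℕ)) * krylov A v := by
    refine Matrix.ext_of_mulVec_single fun j => ?_
    have hc : Commute (A ^ (j : ℕ)) (∑ l : Fin (m + 1), w l • A ^ (l : ℕ)) :=
      Commute.sum_right _ _ _ fun _ _ => ((Commute.refl _).pow_pow _ _).smul_right _
    rw [← Matrix.mulVec_mulVec, ← Matrix.mulVec_mulVec, krylov_mulVec_single,
      Matrix.mulVec_mulVec, Matrix.mulVec_mulVec, ← (hAB.pow_left j).eq, ← hc.eq,
      ← Matrix.mulVec_mulVec, ← Matrix.mulVec_mulVec, hw, krylov_mulVec]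
  have hs : ∀ l : ℕ, krylov A v * shiftMatrix R m ^ l = A ^ l * krylov A v := fun l =>
    (show SemiconjBy (krylov A v) (shiftMatrix R m) A from (mul_krylov hA v).symm).pow_right l
  rw [h1, Finset.sum_mul, Finset.mul_sum]
  simp only [mul_smul_comm, hs, smul_mul_assoc]

/-- Coordinates of `B v` in the Krylov basis, multiplied by the determinant of that basis so that
they are polynomial in the entries. -/
def krylovCoord (A B : Matrix (Fin (m + 1)) (Fin (m + 1)) R) (v : Fin (m + 1) → R) :
    Fin (m + 1) → R :=
  (krylov A v).adjugate *ᵥ (B *ᵥ v)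

/-- The polynomial `p` with `B K = K p(J)`, with its constant term split off and denominators
cleared. -/
theorem det_smul_mul_krylov {A B : Matrix (Fin (m + 1)) (Fin (m + 1)) R}
    (hA : A ^ (m + 1) = 0) (hAB : Commute A B) (v : Fin (m + 1) → R) :
    ((krylov A v).det • B) * krylov A v =
      krylov A v * (krylovCoord A B v 0 • 1 + nilToeplitz fun l => krylovCoord A B v l.succ) := by
  have h := mul_krylov_of_commute hA (hAB.smul_right (krylov A v).det) (v := v)
    (w := krylovCoord A B v) (by
      rw [krylovCoord, Matrix.mulVec_mulVec _ (krylov A v), Matrix.mul_adjugate,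
        Matrix.smul_mulVec, Matrix.smul_mulVec, Matrix.one_mulVec])
  rw [h, Fin.sum_univ_succ]
  simp [nilToeplitz]

theorem det_smul_eq_of_mul_eq {K M X : Matrix (Fin (m + 1)) (Fin (m + 1)) R}
    (h : M * K = K * X) : K.det • M = K * X * K.adjugate := by
  rw [← h, Matrix.mul_assoc, Matrix.mul_adjugate, mul_smul_comm, mul_one]

theorem det_smul_det_smul_eq {A B : Matrix (Fin (m + 1)) (Fin (m + 1)) R}
    (hA : A ^ (m + 1) = 0) (hAB : Commute A B) (v : Fin (m + 1) → R)
    (h0 : krylovCoord A B v 0 = 0) :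
    (krylov A v).det • (krylov A v).det • B =
      krylov A v * nilToeplitz (fun l => krylovCoord A B v l.succ) * (krylov A v).adjugate := by
  refine det_smul_eq_of_mul_eq ?_
  rw [det_smul_mul_krylov hA hAB, h0, zero_smul, zero_add]

theorem krylov_eq_of_mul_eq {A g : Matrix (Fin (m + 1)) (Fin (m + 1)) R}
    {v : Fin (m + 1) → R} (h : A * g = g * shiftMatrix R m) (hv : g *ᵥ Pi.single 0 1 = v) :
    krylov A v = g := by
  refine Matrix.ext_of_mulVec_single fun j => ?_
  have hs : g * shiftMatrix R m ^ (j : ℕ) = A ^ (j : ℕ) * g :=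
    (show SemiconjBy g (shiftMatrix R m) A from h.symm).pow_right j
  rw [krylov_mulVec_single, ← hv, Matrix.mulVec_mulVec, ← hs, ← Matrix.mulVec_mulVec]
  congr 1
  ext i
  simp [shiftMatrix_pow_apply, Pi.single_apply, Fin.ext_iff]

section Map

variable {S : Type*} [CommRing S] (φ : R →+* S)

theorem shiftMatrix_map : φ.mapMatrix (shiftMatrix R m) = shiftMatrix S m := by
  ext i j
  simp [shiftMatrix, apply_ite φ]

theorem nilToeplitz_map (c : Fin m → R) :
    φ.mapMatrix (nilToeplitz c) = nilToeplitz fun l => φ (c l) := by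
  simp only [nilToeplitz, map_sum, ← shiftMatrix_map φ, ← map_pow]
  refine Finset.sum_congr rfl fun l _ => ?_
  ext i j
  simp

theorem krylov_map (A : Matrix (Fin (m + 1)) (Fin (m + 1)) R) (v : Fin (m + 1) → R) :
    φ.mapMatrix (krylov A v) = krylov (φ.mapMatrix A) (φ ∘ v) := by
  ext i j
  change φ ((A ^ (j : ℕ) *ᵥ v) i) = (φ.mapMatrix A ^ (j : ℕ) *ᵥ (φ ∘ v)) i
  rw [← map_pow, RingHom.map_mulVec, RingHom.mapMatrix_apply]

theorem krylovCoord_map (A B : Matrix (Fin (m + 1)) (Fin (m + 1)) R) (v : Fin (m + 1) → R)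
    (i : Fin (m + 1)) :
    φ (krylovCoord A B v i) = krylovCoord (φ.mapMatrix A) (φ.mapMatrix B) (φ ∘ v) i := by
  have h : φ ∘ (B *ᵥ v) = φ.mapMatrix B *ᵥ (φ ∘ v) := funext fun k => RingHom.map_mulVec φ B v k
  rw [krylovCoord, krylovCoord, RingHom.map_mulVec, ← krylov_map, ← RingHom.map_adjugate, h]
  rfl

end Map
end Krylov

/-! ### Regular nilpotent matrices -/

section Regular

open Matrix

variable {F : Type*} [Field F] {m : ℕ}

theorem pow_succ_eq_zero_of_isNilpotent {A : Matrix (Fin (m + 1)) (Fin (m + 1)) F}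
    (hA : IsNilpotent A) : A ^ (m + 1) = 0 := by
  have h := Matrix.isNilpotent_charpoly_sub_pow_of_isNilpotent hA
  have h' := sub_eq_zero.1 h.eq_zero
  have := A.aeval_self_charpoly
  rw [h'] at this
  simpa using this

/-- If `A ^ m v ≠ 0` then `v` is a cyclic vector of the nilpotent matrix `A`. -/
theorem det_krylov_ne_zero {A : Matrix (Fin (m + 1)) (Fin (m + 1)) F} (hA : A ^ (m + 1) = 0)
    {v : Fin (m + 1) → F} (hv : A ^ m *ᵥ v ≠ 0) : (krylov A v).det ≠ 0 := by
  intro hdet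
  obtain ⟨c, hc0, hc⟩ := Matrix.exists_mulVec_eq_zero_iff.2 hdet
  rw [krylov_mulVec] at hc
  -- Multiplying a relation by the power of `A` complementary to its lowest term isolates that term.
  have hzero : ∀ k : ℕ, ∀ hk : k < m + 1, c ⟨k, hk⟩ = 0 := by
    intro k
    induction k using Nat.strong_induction_on with
    | _ k ih =>
      intro hk
      have h : A ^ (m - k) * (∑ l, c l • A ^ (l : ℕ)) = c ⟨k, hk⟩ • A ^ m := by
        rw [Finset.mul_sum, Finset.sum_eq_single ⟨k, hk⟩]
        · rw [mul_smul_comm, ← pow_add, show m - k + k = m by omega]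
        · intro l _ hl
          rcases lt_or_ge (l : ℕ) k with hlk | hlk
          · rw [show c l = 0 from ih l hlk l.2, zero_smul, mul_zero]
          · have : (l : ℕ) ≠ k := fun h => hl (Fin.ext h)
            rw [mul_smul_comm, ← pow_add, show m - k + (l : ℕ) = (m + 1) + (l - k - 1) by omega,
              pow_add, hA, zero_mul, smul_zero]
        · simp
      have h2 := congrArg (fun M => M *ᵥ v) h
      simp only [← Matrix.mulVec_mulVec, hc, Matrix.mulVec_zero, Matrix.smul_mulVec] at h2
      exact (smul_eq_zero.1 h2.symm).resolve_right hv
  exact hc0 (funext fun l => hzero l l.2)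

/-- If `ker f` is at most a line, the kernels of the powers of `f` grow by at most one dimension
per step. -/
theorem finrank_ker_pow_le {V : Type*} [AddCommGroup V] [Module F V] [FiniteDimensional F V]
    (f : Module.End F V) (h : Module.finrank F (LinearMap.ker f) ≤ 1) (k : ℕ) :
    Module.finrank F (LinearMap.ker (f ^ k)) ≤ k := by
  induction k with
  | zero =>
    rw [pow_zero, Module.End.one_eq_id, LinearMap.ker_id, finrank_bot]
  | succ k ih =>
    -- `f` maps `ker (f ^ (k + 1))` to `ker (f ^ k)`, with kernel inside `ker f`.
    have hmap : ∀ x ∈ LinearMap.ker (f ^ (k + 1)), f x ∈ LinearMap.ker (f ^ k) := fun x hx => by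
      rw [LinearMap.mem_ker] at hx ⊢
      rwa [← Module.End.mul_apply, ← pow_succ]
    let g := f.restrict hmap
    have h1 := g.finrank_range_add_finrank_ker
    have h2 := (LinearMap.range g).finrank_le
    have h3 : Module.finrank F (LinearMap.ker g) ≤ Module.finrank F (LinearMap.ker f) := by
      refine LinearMap.finrank_le_finrank_of_injective
        (f := ((Submodule.subtype _).comp (LinearMap.ker g).subtype).codRestrict
          (LinearMap.ker f) fun x => ?_) ?_
      · have := congrArg Subtype.val (LinearMap.mem_ker.1 x.2)
        exact this
      · intro x y hxy
        have h := congrArg (fun z : LinearMap.ker f => (z : V)) hxy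
        exact Subtype.ext (Subtype.ext h)
    omega

/-- A nilpotent matrix is 1-regular exactly when its nilpotency index is maximal. -/
theorem isRRegular_one_iff {A : Matrix (Fin (m + 1)) (Fin (m + 1)) F} (hA : IsNilpotent A) :
    IsRRegular 1 A ↔ A ^ m ≠ 0 := by
  have hA' := pow_succ_eq_zero_of_isNilpotent hA
  constructor
  · intro h hm
    have h0 := h 0
    rw [Module.End.eigenspace_zero] at h0
    have h1 := finrank_ker_pow_le _ h0 m
    rw [← Matrix.toLin'_pow, hm, map_zero, LinearMap.ker_zero, finrank_top] at h1
    simp at h1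
  · intro h c
    obtain ⟨v, hv⟩ : ∃ v, A ^ m *ᵥ v ≠ 0 := by
      by_contra! hall
      exact h (Matrix.ext_of_mulVec_single fun j => by rw [hall, Matrix.zero_mulVec])
    have hK := det_krylov_ne_zero hA' hv
    have hpow : ∀ x : Fin (m + 1) → F, A *ᵥ x = c • x → ∀ k : ℕ, A ^ k *ᵥ x = c ^ k • x := by
      intro x hx k
      induction k with
      | zero => simp
      | succ k ih =>
        rw [pow_succ, ← Matrix.mulVec_mulVec, hx, Matrix.mulVec_smul, ih, smul_smul, pow_succ']
    rcases eq_or_ne c 0 with rfl | hc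
    · -- In the Krylov basis `A` is the Jordan block, whose kernel is spanned by the last vector.
      have hker : ∀ x ∈ Module.End.eigenspace (Matrix.toLin' A) (0 : F),
          ∃ a : F, x = a • (A ^ m *ᵥ v) := by
        intro x hx
        rw [Module.End.mem_eigenspace_iff, zero_smul, Matrix.toLin'_apply] at hx
        obtain ⟨y, rfl⟩ : ∃ y, krylov A v *ᵥ y = x :=
          ⟨(krylov A v)⁻¹ *ᵥ x, by
            rw [Matrix.mulVec_mulVec, Matrix.mul_nonsing_inv _ hK.isUnit, Matrix.one_mulVec]⟩
        rw [Matrix.mulVec_mulVec, mul_krylov hA', ← Matrix.mulVec_mulVec] at hx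
        have hy : shiftMatrix F m *ᵥ y = 0 := Matrix.eq_zero_of_mulVec_eq_zero hK hx
        refine ⟨y (Fin.last m), ?_⟩
        have hy' : y = y (Fin.last m) • Pi.single (Fin.last m) 1 := by
          ext i
          refine Fin.lastCases ?_ (fun i => ?_) i
          · simp
          · have h3 := congrFun hy i.succ
            simp only [Matrix.mulVec, dotProduct, shiftMatrix, Matrix.of_apply, ite_mul, one_mul,
              zero_mul, Pi.zero_apply] at h3
            rw [Finset.sum_eq_single i.castSucc] at h3
            · simpa using h3
            · intro b _ hb
              rw [if_neg]
              intro h'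
              exact hb (Fin.ext (by simpa using h'.symm))
            · simp
        conv_lhs => rw [hy', Matrix.mulVec_smul, krylov_mulVec_single]
        simp
      refine finrank_le_one (⟨A ^ m *ᵥ v, ?_⟩ : Module.End.eigenspace (Matrix.toLin' A) (0 : F))
        fun w => ?_
      · rw [Module.End.mem_eigenspace_iff, Matrix.toLin'_apply, zero_smul, Matrix.mulVec_mulVec,
          ← pow_succ', hA', Matrix.zero_mulVec]
      · obtain ⟨a, ha⟩ := hker w w.2
        exact ⟨a, Subtype.ext ha.symm⟩
    · have hbot : Module.End.eigenspace (Matrix.toLin' A) c = ⊥ := by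
        rw [Submodule.eq_bot_iff]
        intro x hx
        rw [Module.End.mem_eigenspace_iff, Matrix.toLin'_apply] at hx
        have h1 := hpow x hx (m + 1)
        rw [hA', Matrix.zero_mulVec] at h1
        exact (smul_eq_zero.1 h1.symm).resolve_left (pow_ne_zero _ hc)
      rw [hbot, finrank_bot]
      exact zero_le_one

theorem exists_det_krylov_ne_zero {A : Matrix (Fin (m + 1)) (Fin (m + 1)) F}
    (hA : IsNilpotent A) (h : IsRRegular 1 A) : ∃ v, (krylov A v).det ≠ 0 := by
  obtain ⟨v, hv⟩ : ∃ v, A ^ m *ᵥ v ≠ 0 := by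
    by_contra! hall
    exact (isRRegular_one_iff hA).1 h
      (Matrix.ext_of_mulVec_single fun j => by rw [hall, Matrix.zero_mulVec])
  exact ⟨v, det_krylov_ne_zero (pow_succ_eq_zero_of_isNilpotent hA) hv⟩

/-- A nilpotent matrix commuting with `A` has no constant term as a polynomial in `A`. -/
theorem krylovCoord_zero_eq_zero {A B : Matrix (Fin (m + 1)) (Fin (m + 1)) F}
    (hA : A ^ (m + 1) = 0) (hB : IsNilpotent B) (hAB : Commute A B) {v : Fin (m + 1) → F}
    (hK : (krylov A v).det ≠ 0) : krylovCoord A B v 0 = 0 := by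
  set K := krylov A v
  set w := krylovCoord A B v
  set N := nilToeplitz fun l => w l.succ
  have h : (K.det • B) * K = K * (w 0 • 1 + N) := det_smul_mul_krylov hA hAB v
  have hKu : IsUnit K := (Matrix.isUnit_iff_isUnit_det _).2 hK.isUnit
  -- `w 0 • 1 + N` is similar to a multiple of `B`, and `N` is nilpotent.
  have hnil : IsNilpotent (w 0 • (1 : Matrix (Fin (m + 1)) (Fin (m + 1)) F) + N) := by
    obtain ⟨r, hr⟩ := hB
    refine ⟨r, ?_⟩
    have hs : K * (w 0 • 1 + N) ^ r = (K.det • B) ^ r * K :=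
      (show SemiconjBy K _ _ from h.symm).pow_right r
    rw [smul_pow, hr, smul_zero, zero_mul] at hs
    exact hKu.mul_right_eq_zero.1 hs
  have hscal : IsNilpotent (w 0 • (1 : Matrix (Fin (m + 1)) (Fin (m + 1)) F)) := by
    have hc : Commute (w 0 • (1 : Matrix (Fin (m + 1)) (Fin (m + 1)) F) + N) N :=
      ((Commute.one_left N).smul_left _).add_left (Commute.refl N)
    simpa using hc.isNilpotent_sub hnil (isNilpotent_nilToeplitz _)
  obtain ⟨r, hr⟩ := hscal
  rw [smul_pow, one_pow] at hr
  have := congrFun (congrFun hr 0) 0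
  simp only [Matrix.smul_apply, Matrix.one_apply_eq, smul_eq_mul, mul_one,
    Matrix.zero_apply] at this
  exact IsNilpotent.eq_zero ⟨r, this⟩

end Regular

/-! ### Parametrization of the tuples with regular first matrix -/

section Parametrization

open Matrix

variable {R : Type*} [CommRing R] {e m : ℕ}

/-- The tuple `(s g J adj(g), g p₁(J) adj(g), …, g p_e(J) adj(g))`, where `p_k` is the polynomial
without constant term with coefficients `c k`. The adjugate is used instead of the inverse so that
the entries are polynomials in the parameters. -/
def conjTuple (g : Matrix (Fin (m + 1)) (Fin (m + 1)) R) (s : R) (c : Fin e → Fin m → R) :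
    Fin (e + 1) → Matrix (Fin (m + 1)) (Fin (m + 1)) R :=
  Fin.cons (g * (s • shiftMatrix R m) * g.adjugate)
    fun k => g * nilToeplitz (c k) * g.adjugate

theorem conjTuple_map {S : Type*} [CommRing S] (φ : R →+* S)
    (g : Matrix (Fin (m + 1)) (Fin (m + 1)) R) (s : R) (c : Fin e → Fin m → R)
    (k : Fin (e + 1)) :
    φ.mapMatrix (conjTuple g s c k) =
      conjTuple (φ.mapMatrix g) (φ s) (fun i j => φ (c i j)) k := by
  have hs : φ.mapMatrix (s • shiftMatrix R m) = φ s • shiftMatrix S m := by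
    rw [← shiftMatrix_map φ]; ext i j; simp
  refine Fin.cases ?_ (fun k => ?_) k
  · simp only [conjTuple, Fin.cons_zero, map_mul, RingHom.map_adjugate, hs]
  · simp only [conjTuple, Fin.cons_succ, map_mul, RingHom.map_adjugate, nilToeplitz_map]

theorem mul_adjugate_mul_self (g X : Matrix (Fin (m + 1)) (Fin (m + 1)) R) :
    g * X * g.adjugate * g = g * (g.det • X) := by
  rw [Matrix.mul_assoc, Matrix.adjugate_mul, mul_smul_comm, mul_one, mul_smul_comm]

variable {F : Type*} [Field F]

theorem eq_mul_inv_smul_of_mul_eq {K M X : Matrix (Fin (m + 1)) (Fin (m + 1)) F}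
    (hK : K.det ≠ 0) (h : M * K = K * X) : M = K * (K.det⁻¹ • X) * K.adjugate := by
  rw [mul_smul_comm, smul_mul_assoc, ← det_smul_eq_of_mul_eq h, smul_smul, inv_mul_cancel₀ hK,
    one_smul]

theorem conjTuple_mem_firstRegularTuples {g : Matrix (Fin (m + 1)) (Fin (m + 1)) F} {s : F}
    (hg : g.det ≠ 0) (hs : s ≠ 0) (c : Fin e → Fin m → F) :
    conjTuple g s c ∈ firstRegularTuples F (e + 1) (m + 1) := by
  have hgu : IsUnit g := (Matrix.isUnit_iff_isUnit_det _).2 hg.isUnit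
  let X : Fin (e + 1) → Matrix (Fin (m + 1)) (Fin (m + 1)) F :=
    Fin.cons (s • shiftMatrix F m) fun k => nilToeplitz (c k)
  have hX : ∀ k, conjTuple g s c k = g * X k * g.adjugate := fun k => by
    refine Fin.cases ?_ (fun k => ?_) k <;> simp [conjTuple, X]
  have hcomm : ∀ i j, Commute (X i) (X j) := by
    intro i j
    refine Fin.cases ?_ (fun i => ?_) i <;> refine Fin.cases ?_ (fun j => ?_) j <;>
      simp only [X, Fin.cons_zero, Fin.cons_succ]
    · exact Commute.refl _
    · exact (commute_shiftMatrix_nilToeplitz _).smul_left _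
    · exact ((commute_shiftMatrix_nilToeplitz _).smul_left _).symm
    · exact commute_nilToeplitz _ _
  have hnil : ∀ i, IsNilpotent (X i) := by
    intro i
    refine Fin.cases ?_ (fun i => ?_) i <;> simp only [X, Fin.cons_zero, Fin.cons_succ]
    · exact ⟨m + 1, by rw [smul_pow, shiftMatrix_pow_succ_eq_zero, smul_zero]⟩
    · exact isNilpotent_nilToeplitz _
  have hsemi : ∀ (k : Fin (e + 1)) (r : ℕ), conjTuple g s c k ^ r * g = g * (g.det • X k) ^ r :=
    fun k r => by
      rw [hX]
      exact ((show SemiconjBy g _ _ from (mul_adjugate_mul_self g (X k)).symm).pow_right r).symm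
  have hnil' : ∀ i, IsNilpotent (conjTuple g s c i) := fun i => by
    obtain ⟨r, hr⟩ := hnil i
    refine ⟨r, hgu.mul_left_eq_zero.1 ?_⟩
    rw [hsemi, smul_pow, hr, smul_zero, mul_zero]
  refine ⟨⟨fun i j => ?_, hnil'⟩, (isRRegular_one_iff (hnil' 0)).2 fun h0 => ?_⟩
  · rw [hX, hX, ← Matrix.mul_assoc, ← Matrix.mul_assoc, ← Matrix.mul_assoc, ← Matrix.mul_assoc,
      mul_adjugate_mul_self, mul_adjugate_mul_self]
    congr 1
    rw [Matrix.mul_assoc, Matrix.mul_assoc, smul_mul_assoc, smul_mul_assoc, (hcomm i j).eq]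
  · have h1 := hsemi 0 m
    rw [h0, zero_mul, eq_comm, hgu.mul_right_eq_zero] at h1
    simp only [X, Fin.cons_zero, smul_smul, smul_pow (g.det * s)] at h1
    exact (smul_ne_zero (pow_ne_zero _ (mul_ne_zero hg hs))
      shiftMatrix_pow_ne_zero) h1

/-- In a Krylov basis of the first matrix every tuple in `R₁` takes the form `conjTuple`. -/
theorem exists_eq_conjTuple {A : Fin (e + 1) → Matrix (Fin (m + 1)) (Fin (m + 1)) F}
    (hA : A ∈ firstRegularTuples F (e + 1) (m + 1)) :
    ∃ (g : Matrix (Fin (m + 1)) (Fin (m + 1)) F) (s : F) (c : Fin e → Fin m → F),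
      g.det ≠ 0 ∧ s ≠ 0 ∧ A = conjTuple g s c := by
  obtain ⟨⟨hcomm, hnil⟩, hreg⟩ := hA
  obtain ⟨v, hv⟩ := exists_det_krylov_ne_zero (hnil 0) hreg
  have h0 := pow_succ_eq_zero_of_isNilpotent (hnil 0)
  refine ⟨krylov (A 0) v, (krylov (A 0) v).det⁻¹,
    fun k l => (krylov (A 0) v).det⁻¹ * ((krylov (A 0) v).det⁻¹ *
      krylovCoord (A 0) (A k.succ) v l.succ), hv, inv_ne_zero hv, funext fun k => ?_⟩
  have hN : ∀ (a : F) (c : Fin m → F), nilToeplitz (fun l => a * c l) = a • nilToeplitz c :=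
    fun a c => by simp only [nilToeplitz, Finset.smul_sum, smul_smul]
  refine Fin.cases ?_ (fun k => ?_) k
  · exact eq_mul_inv_smul_of_mul_eq hv (mul_krylov h0 v)
  · simp only [conjTuple, Fin.cons_succ]
    rw [hN]
    refine eq_mul_inv_smul_of_mul_eq hv ?_
    have h := det_smul_mul_krylov h0 (hcomm 0 k.succ) v
    rw [krylovCoord_zero_eq_zero h0 (hnil _) (hcomm 0 k.succ) hv, zero_smul, zero_add,
      smul_mul_assoc] at h
    rw [hN, mul_smul_comm, ← h, smul_smul, inv_mul_cancel₀ hv, one_smul]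

/-- Off the hypersurface `det = 0`, both the Krylov matrix of the first standard basis vector and
the Krylov coordinates of the other matrices can be prescribed. -/
theorem exists_mem_firstRegularTuples_of_det_ne_zero
    {g : Matrix (Fin (m + 1)) (Fin (m + 1)) F} (hg : g.det ≠ 0)
    (hg0 : ∀ i, g i 0 = Pi.single (M := fun _ => F) 0 1 i) (w : Fin e → Fin m → F) :
    ∃ A ∈ firstRegularTuples F (e + 1) (m + 1),
      krylov (A 0) (Pi.single 0 1) = g ∧
        ∀ k l, krylovCoord (A 0) (A (Fin.succ k)) (Pi.single 0 1) (Fin.succ l) = w k l := by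
  let c : Fin e → Fin m → F := fun k l => (g.det ^ 2)⁻¹ * w k l
  have hge : g *ᵥ Pi.single 0 1 = Pi.single 0 1 := by
    ext i; simp [hg0 i]
  have hk : krylov (conjTuple g g.det⁻¹ c 0) (Pi.single 0 1) = g := by
    refine krylov_eq_of_mul_eq ?_ hge
    simp only [conjTuple, Fin.cons_zero]
    rw [mul_adjugate_mul_self, smul_smul, mul_inv_cancel₀ hg, one_smul]
  refine ⟨conjTuple g g.det⁻¹ c, conjTuple_mem_firstRegularTuples hg (inv_ne_zero hg) c, hk,
    fun k l => ?_⟩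
  rw [krylovCoord, hk]
  simp only [conjTuple, Fin.cons_succ]
  conv_lhs => rw [← hge]
  rw [Matrix.mulVec_mulVec, Matrix.mulVec_mulVec, Matrix.mul_assoc g.adjugate,
    mul_adjugate_mul_self, ← Matrix.mul_assoc, Matrix.adjugate_mul]
  simp only [smul_mul_assoc, one_mul, Matrix.mulVec_single_one, Matrix.col_apply]
  rw [Matrix.smul_apply, Matrix.smul_apply, nilToeplitz_apply_succ_zero, smul_eq_mul, smul_eq_mul]
  simp only [c]
  field_simp

end Parametrization

/-! ### The coordinate ring of the closure -/

section CoordinateRing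

open Matrix MvPolynomial

variable {F : Type*} [Field F] {e m : ℕ}

/-- The entries of a tuple of matrices, as a point of affine space. -/
def tupleCoord {F : Type*} {d n : ℕ} (A : Fin d → Matrix (Fin n) (Fin n) F) :
    Fin d × Fin n × Fin n → F :=
  fun k => A k.1 k.2.1 k.2.2

/-- The ideal of polynomials in the entries of `e + 1` matrices of size `m + 1` that vanish on the
tuples in `R₁`. -/
def regularIdeal (F : Type*) [Field F] (e m : ℕ) :
    Ideal (MvPolynomial (Fin (e + 1) × Fin (m + 1) × Fin (m + 1)) F) :=
  vanishingIdeal F (tupleCoord '' firstRegularTuples F (e + 1) (m + 1))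

theorem mem_regularIdeal_iff {p : MvPolynomial (Fin (e + 1) × Fin (m + 1) × Fin (m + 1)) F} :
    p ∈ regularIdeal F e m ↔
      ∀ A ∈ firstRegularTuples F (e + 1) (m + 1), eval (tupleCoord A) p = 0 := by
  simp [regularIdeal]

/-- The matrix whose entries are the coordinate functions of the `k`-th matrix of a tuple. -/
noncomputable def genericMatrix (F : Type*) [Field F] {d n : ℕ} (k : Fin d) :
    Matrix (Fin n) (Fin n) (MvPolynomial (Fin d × Fin n × Fin n) F) :=
  Matrix.of fun i j => X (k, i, j)

theorem eval_genericMatrix {d n : ℕ} (A : Fin d → Matrix (Fin n) (Fin n) F) (k : Fin d) :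
    (eval (tupleCoord A)).mapMatrix (genericMatrix F k) = A k := by
  ext i j
  simp [genericMatrix, tupleCoord]

theorem comp_single_one {R S ι : Type*} [CommRing R] [CommRing S] [DecidableEq ι] (φ : R →+* S)
    (i : ι) : φ ∘ (Pi.single i 1 : ι → R) = Pi.single i 1 := by
  ext j
  simp [Pi.single_apply, apply_ite φ]

theorem isPrime_regularIdeal [Infinite F] : (regularIdeal F e m).IsPrime := by
  let σ := (Fin (m + 1) × Fin (m + 1)) ⊕ (Unit ⊕ (Fin e × Fin m))
  let g : Matrix (Fin (m + 1)) (Fin (m + 1)) (MvPolynomial σ F) :=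
    Matrix.of fun i j => X (Sum.inl (i, j))
  let s : MvPolynomial σ F := X (Sum.inr (Sum.inl ()))
  let c : Fin e → Fin m → MvPolynomial σ F := fun k l => X (Sum.inr (Sum.inr (k, l)))
  let y : Matrix (Fin (m + 1)) (Fin (m + 1)) F → F → (Fin e → Fin m → F) → σ → F := fun g' s' c' =>
    Sum.elim (fun p => g' p.1 p.2) (Sum.elim (fun _ => s') fun p => c' p.1 p.2)
  have hg : ∀ g' s' c', (eval (y g' s' c')).mapMatrix g = g' := fun g' s' c' => by
    ext i j; simp [g, y]
  have hev : ∀ (z : σ → F) k, eval z (conjTuple g s c k.1 k.2.1 k.2.2) =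
      tupleCoord (conjTuple ((eval z).mapMatrix g) (eval z s) fun i j => eval z (c i j)) k :=
    fun z k => by
      rw [tupleCoord, ← conjTuple_map]; rfl
  refine isPrime_vanishingIdeal_of_parametrization
    (fun k => conjTuple g s c k.1 k.2.1 k.2.2) (h := g.det * s) ?_ fun x => ?_
  · intro h
    have h1 := congrArg (eval (y 1 1 0)) h
    rw [map_mul, RingHom.map_det, hg, map_zero] at h1
    simp [s, y] at h1
  · constructor
    · rintro ⟨A, hA, rfl⟩
      obtain ⟨g', s', c', hg', hs', rfl⟩ := exists_eq_conjTuple hA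
      refine ⟨y g' s' c', ?_, fun k => ?_⟩
      · rw [map_mul, RingHom.map_det, hg]
        simpa [s, y] using ⟨hg', hs'⟩
      · rw [hev, hg]
        simp [s, c, y]
    · rintro ⟨z, hz, hx⟩
      rw [map_mul, RingHom.map_det] at hz
      refine ⟨_, conjTuple_mem_firstRegularTuples (left_ne_zero_of_mul hz)
        (right_ne_zero_of_mul hz) fun i j => eval z (c i j), ?_⟩
      funext k
      rw [hx, hev]

/-- The coordinate functions that rationally parametrize `R₁`: the columns after the first of the
Krylov matrix of the first matrix and the first standard basis vector, and the nonconstant Krylov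
coordinates of the other matrices. -/
noncomputable def regularCoordinates (F : Type*) [Field F] (e m : ℕ) :
    (Fin (m + 1) × Fin m) ⊕ (Fin e × Fin m) →
      MvPolynomial (Fin (e + 1) × Fin (m + 1) × Fin (m + 1)) F :=
  Sum.elim (fun p => krylov (genericMatrix F 0) (Pi.single 0 1) p.1 p.2.succ)
    fun p => krylovCoord (genericMatrix F 0) (genericMatrix F p.1.succ) (Pi.single 0 1) p.2.succ

theorem eval_krylov_genericMatrix
    (A : Fin (e + 1) → Matrix (Fin (m + 1)) (Fin (m + 1)) F) :
    (eval (tupleCoord A)).mapMatrix (krylov (genericMatrix F 0) (Pi.single 0 1)) =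
      krylov (A 0) (Pi.single 0 1) := by
  rw [krylov_map, eval_genericMatrix, comp_single_one]

theorem eval_krylovCoord_genericMatrix
    (A : Fin (e + 1) → Matrix (Fin (m + 1)) (Fin (m + 1)) F) (k : Fin (e + 1)) (i : Fin (m + 1)) :
    eval (tupleCoord A) (krylovCoord (genericMatrix F 0) (genericMatrix F k) (Pi.single 0 1) i) =
      krylovCoord (A 0) (A k) (Pi.single 0 1) i := by
  rw [krylovCoord_map, eval_genericMatrix, eval_genericMatrix, comp_single_one]

theorem algebraicIndependent_regularCoordinates [Infinite F] :
    AlgebraicIndependent F fun t =>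
      Ideal.Quotient.mk (regularIdeal F e m) (regularCoordinates F e m t) := by
  let τ := (Fin (m + 1) × Fin m) ⊕ (Fin e × Fin m)
  let g : Matrix (Fin (m + 1)) (Fin (m + 1)) (MvPolynomial τ F) :=
    Matrix.of fun i j => Fin.cases (Pi.single (M := fun _ => MvPolynomial τ F) 0 1 i)
      (fun j => X (Sum.inl (i, j))) j
  have hg : ∀ a : τ → F, (eval a).mapMatrix g = Matrix.of fun i j =>
      Fin.cases (Pi.single (M := fun _ => F) 0 1 i) (fun j => a (Sum.inl (i, j))) j := by
    intro a
    ext i j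
    refine Fin.cases ?_ (fun j => ?_) j
    · simp [g, Pi.single_apply, apply_ite (eval a)]
    · simp [g]
  refine algebraicIndependent_quotient_vanishingIdeal (D := g.det) _ ?_ fun a ha => ?_
  · intro h
    have h1 := congrArg (eval (Sum.elim (fun p => if p.1 = p.2.succ then 1 else 0) 0 : τ → F)) h
    rw [RingHom.map_det, hg, map_zero] at h1
    refine one_ne_zero (α := F) (Eq.trans ?_ h1)
    rw [← Matrix.det_one (n := Fin (m + 1))]
    congr 1
    ext i j
    refine Fin.cases ?_ (fun j => ?_) j
    · simp [Matrix.one_apply, Pi.single_apply]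
    · simp [Matrix.one_apply]
  · rw [RingHom.map_det] at ha
    obtain ⟨A, hA, hk, hw⟩ := exists_mem_firstRegularTuples_of_det_ne_zero (e := e) ha
      (fun i => by rw [hg]; simp) fun k l => a (Sum.inr (k, l))
    refine ⟨_, ⟨A, hA, rfl⟩, ?_⟩
    rintro (⟨i, j⟩ | ⟨k, l⟩)
    · have h := eval_krylov_genericMatrix A
      rw [hk, hg] at h
      exact congrFun (congrFun h i) j.succ
    · exact (eval_krylovCoord_genericMatrix A _ _).trans (hw k l)

theorem mapMatrix_mk_eq_zero
    {M : Matrix (Fin (m + 1)) (Fin (m + 1))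
      (MvPolynomial (Fin (e + 1) × Fin (m + 1) × Fin (m + 1)) F)}
    (hM : ∀ A ∈ firstRegularTuples F (e + 1) (m + 1), (eval (tupleCoord A)).mapMatrix M = 0) :
    (Ideal.Quotient.mk (regularIdeal F e m)).mapMatrix M = 0 := by
  ext i j
  refine Ideal.Quotient.eq_zero_iff_mem.2 (mem_regularIdeal_iff.2 fun A hA => ?_)
  exact congrFun (congrFun (hM A hA) i) j

/-- The coordinate functions `regularCoordinates` form a transcendence basis of the coordinate ring:
on the closure of `R₁`, multiples of the entries of all matrices by powers of the Krylov determinant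
are polynomials in these functions. -/
theorem isTranscendenceBasis_regularCoordinates [Infinite F] :
    IsTranscendenceBasis F fun t =>
      Ideal.Quotient.mk (regularIdeal F e m) (regularCoordinates F e m t) := by
  have hprime : (regularIdeal F e m).IsPrime := isPrime_regularIdeal
  set q := Ideal.Quotient.mk (regularIdeal F e m) with hq
  let x := fun t => q (regularCoordinates F e m t)
  let S := Algebra.adjoin F (Set.range x)
  let B : Fin (e + 1) → Matrix (Fin (m + 1)) (Fin (m + 1)) _ := fun k =>
    q.mapMatrix (genericMatrix F k)
  let K := krylov (B 0) (Pi.single 0 1)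
  let w := fun k => krylovCoord (B 0) (B k) (Pi.single 0 1)
  have hK : q.mapMatrix (krylov (genericMatrix F 0) (Pi.single 0 1)) = K := by
    rw [krylov_map, comp_single_one]
  have hw : ∀ k i, q (krylovCoord (genericMatrix F 0) (genericMatrix F k) (Pi.single 0 1) i) =
      w k i := fun k i => by
    rw [krylovCoord_map, comp_single_one]
  have hcomm : ∀ k l, Commute (B k) (B l) := fun k l => by
    have h := mapMatrix_mk_eq_zero (F := F) (e := e) (m := m)
      (M := genericMatrix F k * genericMatrix F l - genericMatrix F l * genericMatrix F k)
      fun A hA => by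
        rw [map_sub, map_mul, map_mul, eval_genericMatrix, eval_genericMatrix, hA.1.1 k l, sub_self]
    rw [map_sub, map_mul, map_mul, sub_eq_zero] at h
    exact h
  have hpow : B 0 ^ (m + 1) = 0 := by
    have h := mapMatrix_mk_eq_zero (F := F) (e := e) (M := genericMatrix F 0 ^ (m + 1))
      fun A hA => by
        rw [map_pow, eval_genericMatrix, pow_succ_eq_zero_of_isNilpotent (hA.1.2 0)]
    rw [map_pow] at h
    exact h
  have hdet : K.det ≠ 0 := by
    rw [← hK, ← RingHom.map_det, hq, Ne, Ideal.Quotient.eq_zero_iff_mem, mem_regularIdeal_iff]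
    intro h
    obtain ⟨A, hA, hk, -⟩ := exists_mem_firstRegularTuples_of_det_ne_zero (F := F) (e := e)
      (g := (1 : Matrix (Fin (m + 1)) (Fin (m + 1)) F)) (by simp)
      (fun i => by simp [Matrix.one_apply, Pi.single_apply]) 0
    have h1 := h A hA
    rw [RingHom.map_det, eval_krylov_genericMatrix, hk, Matrix.det_one] at h1
    exact one_ne_zero h1
  have hw0 : ∀ k, w k 0 = 0 := fun k => by
    refine (mul_eq_zero.1 (?_ : K.det * w k 0 = 0)).resolve_left hdet
    rw [← hK, ← hw, ← RingHom.map_det, ← map_mul, hq, Ideal.Quotient.eq_zero_iff_mem,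
      mem_regularIdeal_iff]
    intro A hA
    rw [map_mul, RingHom.map_det, eval_krylov_genericMatrix, eval_krylovCoord_genericMatrix]
    by_cases h : (krylov (A 0) (Pi.single 0 1)).det = 0
    · rw [h, zero_mul]
    · rw [krylovCoord_zero_eq_zero (pow_succ_eq_zero_of_isNilpotent (hA.1.2 0)) (hA.1.2 k)
        (hA.1.1 0 k) h, mul_zero]
  have hxS : ∀ t, x t ∈ S := fun t => Algebra.subset_adjoin ⟨t, rfl⟩
  have hKS : ∀ i j, K i j ∈ S := fun i j => by
    refine Fin.cases ?_ (fun j => ?_) j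
    · rw [show K i 0 = Pi.single (M := fun _ => _) 0 1 i from krylov_apply_zero _ _ _,
        Pi.single_apply]
      split_ifs
      · exact S.one_mem
      · exact S.zero_mem
    · rw [← hK]
      exact hxS (Sum.inl (i, j))
  -- Over the subalgebra `S`, the matrix `K` and the coordinates `w` are images of `K'` and `w'`.
  let K' : Matrix (Fin (m + 1)) (Fin (m + 1)) S := Matrix.of fun i j => ⟨K i j, hKS i j⟩
  let w' : Fin e → Fin m → S := fun k l => ⟨w k.succ l.succ, by
    rw [← hw]; exact hxS (Sum.inr (k, l))⟩
  let φ : S →+* _ := S.val.toRingHom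
  have hK' : φ.mapMatrix K' = K := rfl
  have hmem : ∀ (M : Matrix (Fin (m + 1)) (Fin (m + 1)) S) i j, φ.mapMatrix M i j ∈ S :=
    fun M i j => (M i j).2
  have hdetS : K.det ∈ S := by
    rw [← hK', ← RingHom.map_det]
    exact K'.det.2
  have hB0 : K.det • B 0 = φ.mapMatrix (K' * shiftMatrix S m * K'.adjugate) := by
    rw [det_smul_eq_of_mul_eq (mul_krylov hpow _), map_mul, map_mul, RingHom.map_adjugate, hK',
      shiftMatrix_map]
  have hB : ∀ k : Fin e, K.det • K.det • B k.succ =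
      φ.mapMatrix (K' * nilToeplitz (w' k) * K'.adjugate) := fun k => by
    have h := det_smul_det_smul_eq hpow (hcomm 0 k.succ) (Pi.single 0 1) (hw0 k.succ)
    refine h.trans ?_
    rw [map_mul, map_mul, RingHom.map_adjugate, hK', nilToeplitz_map]
    rfl
  have hdom : IsDomain (MvPolynomial (Fin (e + 1) × Fin (m + 1) × Fin (m + 1)) F ⧸
      regularIdeal F e m) := Ideal.Quotient.isDomain _
  rw [isTranscendenceBasis_iff_algebraicIndependent_isAlgebraic]
  refine ⟨algebraicIndependent_regularCoordinates, ?_⟩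
  refine isAlgebraic_of_adjoin_eq_top S (s := Set.range fun i => q (X i)) ?_ ?_
  · have h : (Set.range fun i => q (X i)) =
        (Ideal.Quotient.mkₐ F (regularIdeal F e m)) '' Set.range X := by
      rw [← Set.range_comp]; rfl
    rw [h, ← AlgHom.map_adjoin, adjoin_range_X, Algebra.map_top, AlgHom.range_eq_top]
    exact Ideal.Quotient.mkₐ_surjective _ _
  · rintro _ ⟨⟨k, i, j⟩, rfl⟩
    refine Fin.cases ?_ (fun k => ?_) k
    · refine ⟨K.det, hdetS, hdet, ?_⟩
      have h := hmem (K' * shiftMatrix S m * K'.adjugate) i j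
      rw [← hB0] at h
      exact h
    · refine ⟨K.det * K.det, S.mul_mem hdetS hdetS, mul_ne_zero hdet hdet, ?_⟩
      have h := hmem (K' * nilToeplitz (w' k) * K'.adjugate) i j
      rw [← hB, smul_smul] at h
      exact h

theorem ringKrullDim_quotient_regularIdeal [Infinite F] :
    ringKrullDim (MvPolynomial (Fin (e + 1) × Fin (m + 1) × Fin (m + 1)) F ⧸ regularIdeal F e m) =
      (((m + 1 + e) * m : ℕ) : WithBot ℕ∞) := by
  have hprime : (regularIdeal F e m).IsPrime := isPrime_regularIdeal
  have hdom : IsDomain (MvPolynomial (Fin (e + 1) × Fin (m + 1) × Fin (m + 1)) F ⧸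
      regularIdeal F e m) := Ideal.Quotient.isDomain _
  rw [ringKrullDim_eq_card_of_isTranscendenceBasis
    (isTranscendenceBasis_regularCoordinates (F := F) (e := e) (m := m))]
  congr 2
  simp [add_mul]

end CoordinateRing

/-! ### Irreducibility and dimension of the closure -/

section Main

open MvPolynomial

attribute [local instance] zariskiTopology tupleZariskiTopology

variable {F : Type*} [Field F]

theorem isHomeomorph_tupleCoord (d n : ℕ) :
    IsHomeomorph (tupleCoord (F := F) (d := d) (n := n)) := by
  rw [isHomeomorph_iff_isEmbedding_surjective]
  refine ⟨⟨⟨rfl⟩, fun A B h => ?_⟩, fun x => ⟨fun k => Matrix.of fun i j => x (k, i, j), rfl⟩⟩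
  funext k
  ext i j
  exact congrFun h (k, i, j)

end Main

theorem mainTheorem7 (F : Type*) [Field F] [IsAlgClosed F] (d n : ℕ) [NeZero d] (hn : 1 ≤ n) :
    letI := tupleZariskiTopology F d n
    IsIrreducible (closure (firstRegularTuples F d n)) ∧
      topologicalKrullDim (closure (firstRegularTuples F d n)) =
        (((n + d - 1) * (n - 1) : ℕ) : WithBot ℕ∞) := by
  let : TopologicalSpace (Fin d → Matrix (Fin n) (Fin n) F) := tupleZariskiTopology F d n
  let : TopologicalSpace (Fin d × Fin n × Fin n → F) := zariskiTopology F _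
  obtain ⟨m, rfl⟩ : ∃ m, n = m + 1 := ⟨n - 1, by omega⟩
  obtain ⟨e, rfl⟩ : ∃ e, d = e + 1 := ⟨d - 1, by have := NeZero.pos d; omega⟩
  have hinf : Infinite F := IsAlgClosed.instInfinite
  have hhom := isHomeomorph_tupleCoord (F := F) (e + 1) (m + 1)
  have hcl : tupleCoord '' closure (firstRegularTuples F (e + 1) (m + 1)) =
      MvPolynomial.zeroLocus F (regularIdeal F e m) := by
    rw [← hhom.isClosedEmbedding.closure_image_eq, closure_zariski_eq]
    rfl
  constructor
  · refine isIrreducible_of_isIrreducible_image hhom.isInducing ?_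
    rw [← hhom.isClosedEmbedding.closure_image_eq, isIrreducible_iff_closure,
      isIrreducible_zariski_iff]
    exact isPrime_regularIdeal
  · have h := ((hhom.homeomorph _).image
      (closure (firstRegularTuples F (e + 1) (m + 1)))).isHomeomorph.topologicalKrullDim_eq
    refine h.trans ?_
    change topologicalKrullDim
      ↥(tupleCoord '' closure (firstRegularTuples F (e + 1) (m + 1))) = _
    rw [hcl, topologicalKrullDim_zeroLocus, ringKrullDim_quotient_regularIdeal]
    congr 3
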